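/- Let $S$ be a finite set and let $M=(m_{s,t})_{s,t\in S}$ be a Coxeter matrix over $S$: $m_{s,s}=1$ for all $s \in S$, and $m_{s,t}=m_{t,s}\in\{2,3,4,\dots\}\cup\{\infty\}$ for all $s\neq t$; let $\Gamma$ be the Coxeter graph representing $M$. For letters $a,b$ and an integer $m\ge 2$, let $\Pi(a,b:m)$ denote the word $aba\cdots$ of length $m$. Let $\Sigma=\{\sigma_s\mid s\in S\}$ be a set in one-to-one correspondence with $S$, and let $(A,\Sigma)$ be the Artin system of $\Gamma$, that is, $A$ is the group $$A=\langle \Sigma \mid \Pi(\sigma_s,\sigma_t:m_{s,t})=\Pi(\sigma_t,\sigma_s:m_{s,t})\ \text{for all } s,t\in S,\ s\ne t,\ m_{s,t}\neq\infty\rangle .$$ For a group $G$ generated by $X$ and $\alpha\in G$, let $\lg_X(\alpha)$ denote the minimal length of a word over $X\sqcup X^{-1}$ representing $\alpha$; a word over $X\sqcup X^{-1}$ of length $\lg_X(\alpha)$ representing $\alpha$ is called a geodesic for $\alpha$. Let $T\subseteq S$, let $\Sigma_T=\{\sigma_s\mid s\in T\}$, and let $A_T$ be the subgroup of $A$ generated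 by $\Sigma_T$. Then $A_T$ is convex in $A$ with respect to $\Sigma$: for every $\alpha\in A_T$ and every geodesic $\sigma_{s_1}^{\varepsilon_1}\cdots\sigma_{s_\ell}^{\varepsilon_\ell}$ over $\Sigma\sqcup\Sigma^{-1}$ for $\alpha$ (with $\varepsilon_i \in \{1,-1\}$), we have $s_1,\dots,s_\ell\in T$. In particular, $A_T$ is isometrically embedded in $A$: $\lg_\Sigma(\alpha)=\lg_{\Sigma_T}(\alpha)$ for all $\alpha\in A_T$. -/

import Mathlib

namespace ArtinConvexity

section Words

variable {ι G : Type*} [Group G]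

/-- The element of `G` represented by a word over the alphabet `ι ⊔ ι⁻¹`, for a family `x : ι → G`.
The letter `(i, true)` stands for `x i` and `(i, false)` for `(x i)⁻¹`. -/
def wordProd (x : ι → G) (w : List (ι × Bool)) : G :=
  (w.map fun l => cond l.2 (x l.1) (x l.1)⁻¹).prod

/-- `w` is an expression for `α`. -/
def IsExpression (x : ι → G) (α : G) (w : List (ι × Bool)) : Prop :=
  wordProd x w = α

/-- The length of `α` with respect to the generating family `x`: the minimal length of an
expression for `α` (there is one as soon as `x` generates `G`, see `exists_isExpression`). -/
noncomputable def length (x : ι → G) (α : G) : ℕ :=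
  sInf {n | ∃ w : List (ι × Bool), IsExpression x α w ∧ w.length = n}

/-- A geodesic for `α` is an expression for `α` of length `length x α`. -/
def IsGeodesic (x : ι → G) (α : G) (w : List (ι × Bool)) : Prop :=
  IsExpression x α w ∧ w.length = length x α

/-- The subgroup generated by the members `x i` with `i ∈ T`. -/
def subgroupOf (x : ι → G) (T : Set ι) : Subgroup G :=
  Subgroup.closure (x '' T)

/-- The generators `x i`, `i ∈ T`, as elements of the subgroup they generate. -/
def subgroupGen (x : ι → G) (T : Set ι) (i : T) : subgroupOf x T :=
  ⟨x i, Subgroup.subset_closure ⟨i, i.2, rfl⟩⟩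

/-- The subgroup generated by the `x i`, `i ∈ T`, is convex in `G` with respect to `x`: all
geodesics over the whole alphabet for elements of the subgroup only use letters from `T`. -/
def IsConvex (x : ι → G) (T : Set ι) : Prop :=
  ∀ α ∈ subgroupOf x T, ∀ w : List (ι × Bool), IsGeodesic x α w → ∀ l ∈ w, l.1 ∈ T

/-- The subgroup generated by the `x i`, `i ∈ T`, with its own word length with respect to these
generators, is isometrically embedded in `G`. -/
def IsIsometricallyEmbedded (x : ι → G) (T : Set ι) : Prop :=
  ∀ α : subgroupOf x T, length x (α : G) = length (subgroupGen x T) α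

theorem exists_isExpression (x : ι → G) (h : Subgroup.closure (Set.range x) = ⊤) (α : G) :
    ∃ w, IsExpression x α w := by
  have hα : α ∈ Subgroup.closure (Set.range x) := h ▸ Subgroup.mem_top α
  rw [← FreeGroup.range_lift_eq_closure] at hα
  obtain ⟨g, rfl⟩ := hα
  classical
  refine ⟨g.toWord, ?_⟩
  have hg : FreeGroup.lift x (FreeGroup.mk g.toWord) = FreeGroup.lift x g := by
    rw [FreeGroup.mk_toWord]
  rw [FreeGroup.lift_mk] at hg
  exact hg

theorem closure_range_subgroupGen (x : ι → G) (T : Set ι) :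
    Subgroup.closure (Set.range (subgroupGen x T)) = ⊤ := by
  have h := Subgroup.closure_closure_coe_preimage (k := x '' T)
  suffices h' : Set.range (subgroupGen x T) =
      ((↑) : Subgroup.closure (x '' T) → G) ⁻¹' (x '' T) by
    rw [h']
    exact h
  ext ⟨a, ha⟩
  constructor
  · rintro ⟨i, hi⟩
    exact ⟨i, i.2, congrArg Subtype.val hi⟩
  · rintro ⟨i, hi, hia⟩
    exact ⟨⟨i, hi⟩, Subtype.ext hia⟩

end Words

section Artin

/-- The alternating product `a b a ⋯` with `m` factors. -/
def altProd {G : Type*} [Group G] : G → G → ℕ → G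
  | _, _, 0 => 1
  | a, b, m + 1 => a * altProd b a m

variable {S : Type*}

/-- The relators `Π(s, t : m) Π(t, s : m)⁻¹`, for `s ≠ t` with `m = M s t` finite. In Mathlib's
`CoxeterMatrix` the value `∞` is encoded by `0`. -/
def artinRels (M : CoxeterMatrix S) : Set (FreeGroup S) :=
  {r | ∃ s t : S, s ≠ t ∧ M s t ≠ 0 ∧
    r = altProd (FreeGroup.of s) (FreeGroup.of t) (M s t) *
      (altProd (FreeGroup.of t) (FreeGroup.of s) (M s t))⁻¹}

/-- The Artin group of the Coxeter graph with Coxeter matrix `M`. -/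
abbrev ArtinGroup (M : CoxeterMatrix S) : Type _ :=
  PresentedGroup (artinRels M)

/-- The standard generators `σ_s` of the Artin group. -/
def artinGen (M : CoxeterMatrix S) (s : S) : ArtinGroup M :=
  PresentedGroup.of s

theorem closure_range_artinGen (M : CoxeterMatrix S) :
    Subgroup.closure (Set.range (artinGen M)) = ⊤ :=
  PresentedGroup.closure_range_of (artinRels M)

end Artin

end ArtinConvexity

namespace ArtinConvexity

section GeometricRepresentation

open Polynomial.Chebyshev

variable {B : Type*} (M : CoxeterMatrix B)

/-- The simple coroots of the geometric representation. The value `M i j = 0`, which encodes `∞`,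
gives the pairing `-2`. -/
noncomputable def simpleCoroot (i : B) : Module.Dual ℝ (B →₀ ℝ) :=
  Finsupp.linearCombination ℝ fun j => -2 * Real.cos (Real.pi / M i j)

theorem simpleCoroot_single (i j : B) :
    simpleCoroot M i (Finsupp.single j 1) = -2 * Real.cos (Real.pi / M i j) := by
  simp [simpleCoroot]

theorem simpleCoroot_single_self (i : B) :
    simpleCoroot M i (Finsupp.single i 1) = 2 := by
  simp [simpleCoroot_single]

/-- The simple reflections of the geometric representation. -/
noncomputable def geomReflection (i : B) : (B →₀ ℝ) ≃ₗ[ℝ] (B →₀ ℝ) :=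
  Module.reflection (simpleCoroot_single_self M i)

theorem simpleCoroot_mul_sub_two (i j : B) :
    2 * Real.cos (2 * (Real.pi / M i j)) = simpleCoroot M i (Finsupp.single j 1) *
      simpleCoroot M j (Finsupp.single i 1) - 2 := by
  rw [simpleCoroot_single, simpleCoroot_single, M.symmetric j i, Real.cos_two_mul]
  ring

theorem sin_two_pi_div_ne_zero {m : ℕ} (hm : 3 ≤ m) : Real.sin (2 * (Real.pi / m)) ≠ 0 := by
  have hm' : (3 : ℝ) ≤ m := by exact_mod_cast hm
  have hpi := Real.pi_pos
  refine (Real.sin_pos_of_pos_of_lt_pi (by positivity) ?_).ne'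
  rw [← mul_div_assoc, div_lt_iff₀ (by linarith)]
  nlinarith

theorem eval_S_even {p : ℕ} (hp : 2 ≤ p) :
    (S ℝ ((p : ℤ) - 1)).eval (2 * Real.cos (2 * (Real.pi / (2 * p : ℕ)))) = 0 := by
  have h := S_two_mul_real_cos (2 * (Real.pi / (2 * p : ℕ))) ((p : ℤ) - 1)
  have hp' : (p : ℝ) ≠ 0 := by positivity
  rw [show (((p : ℤ) - 1 : ℤ) + 1 : ℝ) * (2 * (Real.pi / (2 * p : ℕ))) = Real.pi by
    push_cast; field_simp; ring, Real.sin_pi] at h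
  exact (mul_eq_zero.mp h).resolve_right (sin_two_pi_div_ne_zero (by omega))

theorem eval_S_odd {p : ℕ} (hp : 1 ≤ p) :
    (S ℝ (p : ℤ)).eval (2 * Real.cos (2 * (Real.pi / (2 * p + 1 : ℕ)))) +
      (S ℝ ((p : ℤ) - 1)).eval (2 * Real.cos (2 * (Real.pi / (2 * p + 1 : ℕ)))) = 0 := by
  have h₁ := S_two_mul_real_cos (2 * (Real.pi / (2 * p + 1 : ℕ))) (p : ℤ)
  have h₂ := S_two_mul_real_cos (2 * (Real.pi / (2 * p + 1 : ℕ))) ((p : ℤ) - 1)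
  have hp' : (2 * p + 1 : ℝ) ≠ 0 := by positivity
  rw [show (((p : ℤ) - 1 : ℤ) + 1 : ℝ) * (2 * (Real.pi / (2 * p + 1 : ℕ))) =
    Real.pi - Real.pi / (2 * p + 1 : ℕ) by push_cast; field_simp; ring, Real.sin_pi_sub] at h₂
  rw [show (((p : ℤ) : ℝ) + 1) * (2 * (Real.pi / (2 * p + 1 : ℕ))) =
    Real.pi / (2 * p + 1 : ℕ) + Real.pi by push_cast; field_simp; ring, Real.sin_add_pi] at h₁
  refine (mul_eq_zero.mp ?_).resolve_right (sin_two_pi_div_ne_zero (m := 2 * p + 1) (by omega))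
  rw [add_mul, h₁, h₂]
  ring

theorem geomReflection_isLiftable : M.IsLiftable (geomReflection M) := by
  intro i j
  by_cases hij : i = j
  · subst hij
    rw [M.diagonal, pow_one]
    ext1 z
    exact Module.involutive_reflection (simpleCoroot_single_self M i) z
  have h1 := M.off_diagonal i j hij
  ext1 z
  rw [geomReflection, geomReflection, Module.reflection_mul_reflection_pow_apply _ _ _ _
    (2 * Real.cos (2 * (Real.pi / M i j))) (simpleCoroot_mul_sub_two M i j)]
  obtain h0 | h2 | h3 : M i j = 0 ∨ M i j = 2 ∨ 3 ≤ M i j := by omega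
  · simp [h0]
  · have e₁ : simpleCoroot M i (Finsupp.single j 1) = 0 := by
      simp [simpleCoroot_single, h2]
    have e₂ : simpleCoroot M j (Finsupp.single i 1) = 0 := by
      simp [simpleCoroot_single, M.symmetric j i, h2]
    have e₃ : 2 * (Real.pi / (2 : ℕ)) = Real.pi := by push_cast; ring
    rw [e₁, e₂, h2, e₃]
    norm_num
    module
  · obtain ⟨p, hp | hp⟩ := Nat.even_or_odd' (M i j)
    · have e₁ : (((M i j : ℕ) : ℤ) - 2) / 2 = (p : ℤ) - 1 := by omega
      have e₂ : (((M i j : ℕ) : ℤ) - 1) / 2 = (p : ℤ) - 1 := by omega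
      rw [e₁, e₂, hp, eval_S_even (by omega)]
      simp
    · have e₁ : (((M i j : ℕ) : ℤ) - 2) / 2 = (p : ℤ) - 1 := by omega
      have e₂ : (((M i j : ℕ) : ℤ) - 1) / 2 = (p : ℤ) := by omega
      have e₃ : (((M i j : ℕ) : ℤ) - 3) / 2 = (p : ℤ) - 1 := by omega
      have e₄ : ((M i j : ℕ) : ℤ) / 2 = (p : ℤ) := by omega
      rw [e₁, e₂, e₃, e₄, hp, eval_S_odd (by omega)]
      simp

theorem geomReflection_mul_pow_ne_one {i j : B} (hij : i ≠ j) {r : ℕ} (hr : 0 < r)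
    (hrM : M i j = 0 ∨ r < M i j) : (geomReflection M i * geomReflection M j) ^ r ≠ 1 := by
  intro h
  have h' := LinearEquiv.congr_fun h (Finsupp.single i 1)
  rw [geomReflection, geomReflection, Module.reflection_mul_reflection_pow_apply_self _ _ _
    (2 * Real.cos (2 * (Real.pi / M i j))) (simpleCoroot_mul_sub_two M i j)] at h'
  have hi := DFunLike.congr_fun h' i
  have hj := DFunLike.congr_fun h' j
  simp [hij, hij.symm, simpleCoroot_single, M.symmetric j i] at hi hj
  have h1 := M.off_diagonal i j hij
  obtain h0 | h2 | h3 : M i j = 0 ∨ M i j = 2 ∨ 3 ≤ M i j := by omega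
  · simp [h0, S_eval_two] at hj
    omega
  · obtain rfl : r = 1 := by omega
    rw [h2, show 2 * (Real.pi / (2 : ℕ)) = Real.pi by push_cast; ring, Real.cos_pi] at hi
    norm_num at hi
  · have hM : (3 : ℝ) ≤ M i j := by exact_mod_cast h3
    have hpi := Real.pi_pos
    have hcos : Real.cos (Real.pi / M i j) ≠ 0 := by
      refine (Real.cos_pos_of_mem_Ioo ⟨?_, ?_⟩).ne'
      · have : 0 < Real.pi / M i j := by positivity
        linarith
      · exact div_lt_div_of_pos_left hpi (by norm_num) (by linarith)
    have hS := hj.resolve_right hcos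
    have hsin := sin_two_pi_div_ne_zero h3
    set θ := 2 * (Real.pi / M i j) with hθ
    have h₁ := S_two_mul_real_cos θ r
    have h₂ := S_two_mul_real_cos θ (r - 1)
    rw [hS, zero_mul] at h₂
    rw [hS, add_zero] at hi
    push_cast at h₁ h₂
    rw [sub_add_cancel] at h₂
    rw [hi, one_mul, add_mul, one_mul, Real.sin_add, ← h₂, zero_mul, zero_add] at h₁
    have hc : Real.cos (r * θ) = 1 := mul_right_cancel₀ hsin (by rw [one_mul, ← h₁])
    have hr' : (0 : ℝ) < r := by exact_mod_cast hr
    have hrM' : (r : ℝ) < M i j := by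
      exact_mod_cast hrM.resolve_left (by omega)
    have hpos : 0 < r * θ := by positivity
    have hlt : r * θ < 2 * Real.pi := by
      rw [hθ, ← mul_div_assoc, ← mul_div_assoc, div_lt_iff₀ (by linarith)]
      nlinarith
    rw [Real.cos_eq_one_iff_of_lt_of_lt (by linarith) hlt] at hc
    exact hpos.ne' hc

variable {M} {W : Type*} [Group W]

theorem simple_mul_simple_pow_ne_one (cs : CoxeterSystem M W) {i j : B} (hij : i ≠ j) {r : ℕ}
    (hr : 0 < r) (hrM : M i j = 0 ∨ r < M i j) : (cs.simple i * cs.simple j) ^ r ≠ 1 := by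
  intro h
  have h' := congrArg (cs.lift ⟨geomReflection M, geomReflection_isLiftable M⟩) h
  rw [map_pow, map_mul, cs.lift_apply_simple, cs.lift_apply_simple, map_one] at h'
  exact geomReflection_mul_pow_ne_one M hij hr hrM h'

end GeometricRepresentation

section ReflectionCocycle

variable {B W : Type*} [Group W] {M : CoxeterMatrix B} (cs : CoxeterSystem M W)

open Classical in
/-- The permutation of `W × ℤ/2` conjugating the first component by a simple reflection `s` and
switching the sign at `s`. -/
noncomputable def signedConj (i : B) : Equiv.Perm (W × ZMod 2) where
  toFun p := (cs.simple i * p.1 * cs.simple i, p.2 + if p.1 = cs.simple i then 1 else 0)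
  invFun p := (cs.simple i * p.1 * cs.simple i, p.2 + if p.1 = cs.simple i then 1 else 0)
  left_inv p := by
    have h : cs.simple i * p.1 * cs.simple i = cs.simple i ↔ p.1 = cs.simple i := by
      rw [mul_eq_right, ← cs.inv_simple i, inv_mul_eq_one, cs.inv_simple, eq_comm]
    ext
    · simp [mul_assoc]
    · simp [h, add_assoc, CharTwo.add_self_eq_zero]
  right_inv p := by
    have h : cs.simple i * p.1 * cs.simple i = cs.simple i ↔ p.1 = cs.simple i := by
      rw [mul_eq_right, ← cs.inv_simple i, inv_mul_eq_one, cs.inv_simple, eq_comm]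
    ext
    · simp [mul_assoc]
    · simp [h, add_assoc, CharTwo.add_self_eq_zero]

open Classical in
theorem signedConj_apply (i : B) (t : W) (e : ZMod 2) :
    signedConj cs i (t, e) =
      (cs.simple i * t * cs.simple i, e + if t = cs.simple i then 1 else 0) := rfl

theorem simple_mul_pow_simple_mul_simple (i j : B) (k : ℕ) :
    cs.simple j * (cs.simple i * cs.simple j) ^ k =
      ((cs.simple i * cs.simple j) ^ k)⁻¹ * cs.simple j := by
  have h : SemiconjBy (cs.simple j) (cs.simple i * cs.simple j) (cs.simple i * cs.simple j)⁻¹ := by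
    simp [SemiconjBy, mul_assoc]
  rw [(h.pow_right k).eq, inv_pow]

open Classical in
theorem signedConj_mul_pow_apply (i j : B) (k : ℕ) (t : W) (e : ZMod 2) :
    ((signedConj cs i * signedConj cs j) ^ k) (t, e) =
      ((cs.simple i * cs.simple j) ^ k * t * ((cs.simple i * cs.simple j) ^ k)⁻¹,
        e + ∑ q ∈ Finset.range (2 * k),
          if t = ((cs.simple i * cs.simple j) ^ q)⁻¹ * cs.simple j then 1 else 0) := by
  induction k with
  | zero => simp
  | succ k ih =>
    rw [pow_succ', Equiv.Perm.mul_apply, ih, Equiv.Perm.mul_apply, signedConj_apply,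
      signedConj_apply]
    set c := cs.simple i * cs.simple j with hc
    have hj : cs.simple j * c ^ k = (c ^ k)⁻¹ * cs.simple j :=
      simple_mul_pow_simple_mul_simple cs i j k
    have h₁ : c ^ k * t * (c ^ k)⁻¹ = cs.simple j ↔ t = (c ^ (2 * k))⁻¹ * cs.simple j := by
      rw [mul_inv_eq_iff_eq_mul, hj, two_mul, pow_add, mul_inv_rev, mul_assoc (c ^ k)⁻¹,
        ← eq_inv_mul_iff_mul_eq]
    have h₂ : cs.simple j * (c ^ k * t * (c ^ k)⁻¹) * cs.simple j = cs.simple i ↔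
        t = (c ^ (2 * k + 1))⁻¹ * cs.simple j := by
      have hi : cs.simple j * cs.simple i * cs.simple j = c⁻¹ * cs.simple j := by simp [hc]
      rw [← mul_left_inj (cs.simple j), ← mul_right_inj (cs.simple j)]
      simp only [cs.simple_mul_simple_cancel_right, cs.simple_mul_simple_cancel_left]
      rw [← mul_assoc, hi, mul_inv_eq_iff_eq_mul, mul_assoc c⁻¹, hj,
        show 2 * k + 1 = k + 1 + k by omega, pow_add, mul_inv_rev (c ^ (k + 1)),
        ← mul_assoc c⁻¹, ← mul_inv_rev (c ^ k) c, ← pow_succ, ← eq_inv_mul_iff_mul_eq, mul_assoc]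
    rw [mul_add, mul_one, Finset.sum_range_succ, Finset.sum_range_succ]
    simp only [h₁, h₂, add_assoc]
    congr 1
    rw [pow_succ', mul_inv_rev, hc]
    simp only [mul_inv_rev, cs.inv_simple, mul_assoc]

theorem signedConj_isLiftable : M.IsLiftable (signedConj cs) := by
  classical
  intro i j
  ext1 ⟨t, e⟩
  rw [signedConj_mul_pow_apply, two_mul, Finset.sum_range_add]
  simp [pow_add, cs.simple_mul_simple_pow, CharTwo.add_self_eq_zero]

/-- The reflection cocycle: `reflCocycle cs w t` is the parity of the number of occurrences of `t`
in the left inversion sequence of any word for `w`. -/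
noncomputable def reflCocycle (w t : W) : ZMod 2 :=
  (cs.lift ⟨signedConj cs, signedConj_isLiftable cs⟩ w⁻¹ (t, 0)).2

theorem lift_signedConj_apply (w t : W) (e : ZMod 2) :
    cs.lift ⟨signedConj cs, signedConj_isLiftable cs⟩ w (t, e) =
      (w * t * w⁻¹, e + reflCocycle cs w⁻¹ t) := by
  rw [reflCocycle, inv_inv]
  induction w using cs.simple_induction_left generalizing t e with
  | one => simp
  | mul_simple_left w i ih =>
    rw [map_mul, Equiv.Perm.mul_apply, Equiv.Perm.mul_apply, ih t e, ih t 0, cs.lift_apply_simple,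
      signedConj_apply, signedConj_apply]
    simp [mul_assoc, add_assoc]

theorem reflCocycle_mul (u v t : W) :
    reflCocycle cs (u * v) t = reflCocycle cs u t + reflCocycle cs v (u⁻¹ * t * u) := by
  rw [reflCocycle, mul_inv_rev, map_mul, Equiv.Perm.mul_apply, lift_signedConj_apply,
    lift_signedConj_apply]
  simp

@[simp]
theorem reflCocycle_one (t : W) : reflCocycle cs 1 t = 0 := by
  simp [reflCocycle]

open Classical in
theorem reflCocycle_simple (i : B) (t : W) :
    reflCocycle cs (cs.simple i) t = if t = cs.simple i then 1 else 0 := by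
  rw [reflCocycle, cs.inv_simple, cs.lift_apply_simple, signedConj_apply, zero_add]

open Classical in
theorem reflCocycle_wordProd (w : List B) (t : W) :
    reflCocycle cs (cs.wordProd w) t = (cs.leftInvSeq w).count t := by
  induction w generalizing t with
  | nil => simp
  | cons i w ih =>
    rw [cs.wordProd_cons, reflCocycle_mul, reflCocycle_simple, ih, CoxeterSystem.leftInvSeq,
      List.count_cons]
    have h : t = MulAut.conj (cs.simple i) ((cs.simple i)⁻¹ * t * cs.simple i) := by
      simp [mul_assoc]
    conv_rhs => rw [h, List.count_map_of_injective _ _ (MulAut.conj (cs.simple i)).injective]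
    rw [← h]
    push_cast
    rw [add_comm]
    congr 1
    by_cases ht : t = cs.simple i
    · simp [ht]
    · simp [ht, Ne.symm ht]

open Classical in
theorem mem_leftInvSeq_of_reflCocycle_ne_zero {w : List B} {t : W}
    (h : reflCocycle cs (cs.wordProd w) t ≠ 0) : t ∈ cs.leftInvSeq w := by
  rw [reflCocycle_wordProd] at h
  by_contra hn
  simp [List.count_eq_zero_of_not_mem hn] at h

theorem reflCocycle_eq_one_iff_mem {w : List B} (hw : (cs.leftInvSeq w).Nodup) {t : W} :
    reflCocycle cs (cs.wordProd w) t = 1 ↔ t ∈ cs.leftInvSeq w := by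
  classical
  refine ⟨fun h => mem_leftInvSeq_of_reflCocycle_ne_zero cs (by simp [h]), fun h => ?_⟩
  rw [reflCocycle_wordProd, List.count_eq_one_of_mem hw h, Nat.cast_one]

/-- A word for `w` whose left inversion sequence has no repetition is of minimal length. -/
theorem length_le_of_nodup {w w' : List B} (hw : (cs.leftInvSeq w).Nodup)
    (h : cs.wordProd w = cs.wordProd w') : w.length ≤ w'.length := by
  classical
  have hs : (cs.leftInvSeq w).toFinset ⊆ (cs.leftInvSeq w').toFinset := by
    intro t ht
    rw [List.mem_toFinset] at ht ⊢
    rw [← reflCocycle_eq_one_iff_mem cs hw, h] at ht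
    exact mem_leftInvSeq_of_reflCocycle_ne_zero cs (by simp [ht])
  have := (Finset.card_le_card hs).trans (List.toFinset_card_le _)
  rwa [List.toFinset_card_of_nodup hw, cs.length_leftInvSeq, cs.length_leftInvSeq] at this

theorem nodup_of_length_le {w w' : List B} (hw : (cs.leftInvSeq w).Nodup)
    (h : cs.wordProd w = cs.wordProd w') (hl : w'.length ≤ w.length) :
    (cs.leftInvSeq w').Nodup := by
  classical
  have hs : (cs.leftInvSeq w).toFinset ⊆ (cs.leftInvSeq w').toFinset := by
    intro t ht
    rw [List.mem_toFinset] at ht ⊢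
    rw [← reflCocycle_eq_one_iff_mem cs hw, h] at ht
    exact mem_leftInvSeq_of_reflCocycle_ne_zero cs (by simp [ht])
  have := Finset.card_le_card hs
  rw [List.toFinset_card_of_nodup hw, cs.length_leftInvSeq] at this
  rw [← Multiset.coe_nodup, ← Multiset.toFinset_card_eq_card_iff_nodup]
  refine le_antisymm (Multiset.toFinset_card_le _) ?_
  simpa using hl.trans this

theorem simple_injective : Function.Injective cs.simple := by
  intro i j h
  by_contra hij
  have h1 := M.off_diagonal i j hij
  refine simple_mul_simple_pow_ne_one cs hij one_pos (by omega) ?_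
  rw [h, cs.simple_mul_simple_self, one_pow]

theorem exists_word_of_mem_closure {T : Set B} {v : W}
    (hv : v ∈ Subgroup.closure (cs.simple '' T)) :
    ∃ w : List B, (∀ i ∈ w, i ∈ T) ∧ cs.wordProd w = v := by
  induction hv using Subgroup.closure_induction with
  | mem x hx =>
    obtain ⟨i, hi, rfl⟩ := hx
    exact ⟨[i], by simpa using hi, by simp⟩
  | one => exact ⟨[], by simp, by simp⟩
  | mul x y _ _ hx hy =>
    obtain ⟨w, hw, rfl⟩ := hx
    obtain ⟨w', hw', rfl⟩ := hy
    exact ⟨w ++ w', by grind, by simp [cs.wordProd_append]⟩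
  | inv x _ hx =>
    obtain ⟨w, hw, rfl⟩ := hx
    exact ⟨w.reverse, by simpa using hw, by simp⟩

/-- A nontrivial element of the subgroup generated by `T` has a left descent in `T`. -/
theorem exists_reflCocycle_simple_eq_one {T : Set B} {v : W}
    (hv : v ∈ Subgroup.closure (cs.simple '' T)) (hv1 : v ≠ 1) :
    ∃ i ∈ T, reflCocycle cs v (cs.simple i) = 1 := by
  obtain ⟨w, hw, rfl⟩ := exists_word_of_mem_closure cs hv
  induction hn : w.length using Nat.strong_induction_on generalizing w with
  | _ n ih =>
    obtain _ | ⟨i, u⟩ := w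
    · simp at hv1
    rw [List.forall_mem_cons] at hw
    by_cases h : reflCocycle cs (cs.wordProd (i :: u)) (cs.simple i) = 1
    · exact ⟨i, hw.1, h⟩
    have hu : reflCocycle cs (cs.wordProd u) (cs.simple i) ≠ 0 := by
      rintro h0
      refine h ?_
      rw [cs.wordProd_cons, reflCocycle_mul, reflCocycle_simple]
      simp [h0]
    obtain ⟨k, hk, hk'⟩ := List.mem_iff_getElem.mp (mem_leftInvSeq_of_reflCocycle_ne_zero cs hu)
    have he : cs.wordProd (i :: u) = cs.wordProd (u.eraseIdx k) := by
      rw [cs.wordProd_cons, ← hk', ← List.getD_eq_getElem _ 1 hk, cs.getD_leftInvSeq_mul_wordProd]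
    rw [he] at hv hv1 ⊢
    refine ih _ ?_ _ (fun j hj => hw.2 j (List.mem_of_mem_eraseIdx hj)) hv hv1 rfl
    have := List.length_eraseIdx_le u k
    simp only [List.length_cons] at hn
    omega

end ReflectionCocycle

section Matsumoto

variable {B W : Type*} [Group W] {M : CoxeterMatrix B} (cs : CoxeterSystem M W)

/-- The alternating word `i j i ⋯` of length `m`. -/
def altWord : B → B → ℕ → List B
  | _, _, 0 => []
  | i, j, m + 1 => i :: altWord j i m

@[simp]
theorem length_altWord (i j : B) (m : ℕ) : (altWord i j m).length = m := by
  induction m generalizing i j with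
  | zero => rfl
  | succ m ih => simp [altWord, ih]

theorem prod_map_altWord {G : Type*} [Group G] (f : B → G) (i j : B) (m : ℕ) :
    ((altWord i j m).map f).prod = altProd (f i) (f j) m := by
  induction m generalizing i j with
  | zero => rfl
  | succ m ih => simp [altWord, altProd, ih]

theorem leftInvSeq_altWord (i j : B) (m : ℕ) :
    cs.leftInvSeq (altWord i j m) =
      (List.range m).map fun q => (cs.simple i * cs.simple j) ^ q * cs.simple i := by
  induction m generalizing i j with
  | zero => rfl
  | succ m ih =>
    rw [altWord, CoxeterSystem.leftInvSeq, ih, List.range_succ_eq_map, List.map_cons, List.map_map,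
      List.map_map]
    simp only [pow_zero, one_mul, List.cons.injEq, true_and]
    refine List.map_congr_left fun q _ => ?_
    have h : SemiconjBy (cs.simple i) (cs.simple j * cs.simple i) (cs.simple i * cs.simple j) := by
      simp [SemiconjBy, mul_assoc]
    simp only [Function.comp_apply, MulAut.conj_apply, cs.inv_simple]
    rw [← mul_assoc, (h.pow_right q).eq, pow_succ]
    simp [mul_assoc]

theorem nodup_leftInvSeq_altWord {i j : B} (hij : i ≠ j) {m : ℕ} (hm : M i j = 0 ∨ m ≤ M i j) :
    (cs.leftInvSeq (altWord i j m)).Nodup := by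
  rw [leftInvSeq_altWord]
  refine List.Nodup.map_on ?_ List.nodup_range
  have key : ∀ p q : ℕ, p < q → q < m →
      (cs.simple i * cs.simple j) ^ p * cs.simple i ≠
        (cs.simple i * cs.simple j) ^ q * cs.simple i := by
    intro p q hpq hq h
    rw [mul_left_inj, show q = p + (q - p) by omega, pow_add, left_eq_mul] at h
    exact simple_mul_simple_pow_ne_one cs hij (by omega) (by omega) h
  intro p hp q hq h
  rw [List.mem_range] at hp hq
  rcases lt_trichotomy p q with hlt | heq | hlt
  · exact absurd h (key p q hlt hq)
  · exact heq
  · exact absurd h.symm (key q p hlt hp)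

theorem reflCocycle_altWord_eq_zero {i j : B} (hij : i ≠ j) {m : ℕ} (hm : M i j = 0 ∨ m < M i j) :
    reflCocycle cs (cs.wordProd (altWord i j m)) (cs.simple j) = 0 := by
  by_contra h
  have h := mem_leftInvSeq_of_reflCocycle_ne_zero cs h
  rw [leftInvSeq_altWord, List.mem_map] at h
  obtain ⟨q, hq, h⟩ := h
  rw [List.mem_range] at hq
  refine simple_mul_simple_pow_ne_one cs hij (r := q + 1) (by omega) (by omega) ?_
  rw [pow_succ, ← mul_assoc, h, cs.simple_mul_simple_self]

theorem wordProd_altWord_mul_inv (i j : B) (m : ℕ) :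
    cs.wordProd (altWord i j m) * (cs.wordProd (altWord j i m))⁻¹ =
      (cs.simple i * cs.simple j) ^ m := by
  induction m generalizing i j with
  | zero => simp [altWord]
  | succ m ih =>
    have h : SemiconjBy (cs.simple i) (cs.simple j * cs.simple i) (cs.simple i * cs.simple j) := by
      simp [SemiconjBy, mul_assoc]
    rw [altWord, altWord, cs.wordProd_cons, cs.wordProd_cons, mul_inv_rev, cs.inv_simple, mul_assoc,
      ← mul_assoc (cs.wordProd _), ih, ← mul_assoc, (h.pow_right m).eq, pow_succ, mul_assoc]

theorem wordProd_altWord_comm (i j : B) :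
    cs.wordProd (altWord i j (M i j)) = cs.wordProd (altWord j i (M i j)) := by
  rw [← mul_inv_eq_one, wordProd_altWord_mul_inv, cs.simple_mul_simple_pow]

theorem exists_altWord_prefix {i j : B} (hij : i ≠ j) {x : W} {n : ℕ}
    (hi : reflCocycle cs x (cs.simple i) = 1) (hj : reflCocycle cs x (cs.simple j) = 1)
    (hx : ∃ w : List B, w.length = n ∧ cs.wordProd w = x) (k : ℕ)
    (hk : M i j = 0 ∨ k ≤ M i j) :
    ∃ u : List B, k + u.length = n ∧ cs.wordProd (altWord i j k ++ u) = x := by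
  induction k generalizing i j with
  | zero => simpa [altWord] using hx
  | succ k ih =>
    obtain ⟨u, hu, rfl⟩ := ih hij.symm hj hi (by rw [M.symmetric]; omega)
    have h := hi
    rw [cs.wordProd_append, reflCocycle_mul,
      reflCocycle_altWord_eq_zero cs hij.symm (by rw [M.symmetric]; omega), zero_add] at h
    set p := cs.wordProd (altWord j i k) with hp
    obtain ⟨q, hq, hq'⟩ := List.mem_iff_getElem.mp
      (mem_leftInvSeq_of_reflCocycle_ne_zero cs (h ▸ one_ne_zero))
    have he : p⁻¹ * cs.simple i * p * cs.wordProd u = cs.wordProd (u.eraseIdx q) := by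
      rw [← hq', ← List.getD_eq_getElem _ 1 hq, cs.getD_leftInvSeq_mul_wordProd]
    rw [cs.length_leftInvSeq] at hq
    refine ⟨u.eraseIdx q, ?_, ?_⟩
    · have := List.length_eraseIdx_add_one hq
      omega
    · rw [altWord, List.cons_append, cs.wordProd_cons, cs.wordProd_append, cs.wordProd_append, ← he,
        ← hp]
      simp [mul_assoc]

/-- The element of the Artin group represented by a positive word. -/
def posProd (M : CoxeterMatrix B) (w : List B) : ArtinGroup M :=
  (w.map (artinGen M)).prod

theorem posProd_append (w w' : List B) : posProd M (w ++ w') = posProd M w * posProd M w' := by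
  simp [posProd]

theorem posProd_cons (i : B) (w : List B) : posProd M (i :: w) = artinGen M i * posProd M w := by
  simp [posProd]

theorem map_altProd {G H : Type*} [Group G] [Group H] (f : G →* H) (a b : G) (m : ℕ) :
    f (altProd a b m) = altProd (f a) (f b) m := by
  induction m generalizing a b with
  | zero => simp [altProd]
  | succ m ih => simp [altProd, ih]

theorem posProd_altWord_comm {i j : B} (hij : i ≠ j) (hM : M i j ≠ 0) :
    posProd M (altWord i j (M i j)) = posProd M (altWord j i (M i j)) := by
  have h : PresentedGroup.mk (artinRels M)
      (altProd (FreeGroup.of i) (FreeGroup.of j) (M i j) *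
        (altProd (FreeGroup.of j) (FreeGroup.of i) (M i j))⁻¹) = 1 :=
    PresentedGroup.one_of_mem ⟨i, j, hij, hM, rfl⟩
  rw [map_mul, map_inv, mul_inv_eq_one, map_altProd, map_altProd] at h
  rw [posProd, posProd, prod_map_altWord, prod_map_altWord]
  exact h

/-- **Matsumoto's theorem**: two words without repetition in their left inversion sequences (that
is, two reduced words) for the same element of the Coxeter group represent the same element of the
Artin group. -/
theorem posProd_eq_of_nodup {w w' : List B} (hw : (cs.leftInvSeq w).Nodup)
    (hw' : (cs.leftInvSeq w').Nodup) (h : cs.wordProd w = cs.wordProd w') :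
    posProd M w = posProd M w' := by
  induction hn : w.length generalizing w w' with
  | zero =>
    have := length_le_of_nodup cs hw' h.symm
    rw [List.eq_nil_of_length_eq_zero hn, List.eq_nil_of_length_eq_zero (l := w') (by omega)]
  | succ n ih =>
    have hlen : w'.length = n + 1 :=
      hn ▸ le_antisymm (length_le_of_nodup cs hw' h.symm) (length_le_of_nodup cs hw h)
    have tail {i : B} {u : List B} (hu : (cs.leftInvSeq (i :: u)).Nodup) :
        (cs.leftInvSeq u).Nodup := by
      rw [CoxeterSystem.leftInvSeq, List.nodup_cons] at hu
      exact hu.2.of_map _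
    have same_head {i : B} {u v : List B} (hu : (cs.leftInvSeq (i :: u)).Nodup)
        (hv : (cs.leftInvSeq (i :: v)).Nodup) (huv : cs.wordProd (i :: u) = cs.wordProd (i :: v))
        (hl : u.length = n) : posProd M (i :: u) = posProd M (i :: v) := by
      rw [cs.wordProd_cons, cs.wordProd_cons, mul_right_inj] at huv
      rw [posProd_cons, posProd_cons, ih (tail hu) (tail hv) huv hl]
    obtain _ | ⟨i, u⟩ := w
    · simp at hn
    obtain _ | ⟨j, v⟩ := w'
    · simp at hlen
    rw [List.length_cons, Nat.add_right_cancel_iff] at hn hlen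
    by_cases hij : i = j
    · subst hij
      exact same_head hw hw' h hn
    have hi : reflCocycle cs (cs.wordProd (i :: u)) (cs.simple i) = 1 :=
      (reflCocycle_eq_one_iff_mem cs hw).mpr (by simp [CoxeterSystem.leftInvSeq])
    have hj : reflCocycle cs (cs.wordProd (i :: u)) (cs.simple j) = 1 :=
      h ▸ (reflCocycle_eq_one_iff_mem cs hw').mpr (by simp [CoxeterSystem.leftInvSeq])
    have hpre := exists_altWord_prefix cs hij hi hj ⟨_, rfl, rfl⟩
    have hM : M i j ≠ 0 := by
      intro h0
      obtain ⟨z, hz, -⟩ := hpre ((i :: u).length + 1) (Or.inl h0)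
      omega
    obtain ⟨z, hz, hzx⟩ := hpre (M i j) (Or.inr le_rfl)
    have hzx' : cs.wordProd (altWord j i (M i j) ++ z) = cs.wordProd (i :: u) := by
      rw [← hzx, cs.wordProd_append, cs.wordProd_append, wordProd_altWord_comm]
    have n₁ : (cs.leftInvSeq (altWord i j (M i j) ++ z)).Nodup :=
      nodup_of_length_le cs hw hzx.symm (by simp [← hz])
    have n₂ : (cs.leftInvSeq (altWord j i (M i j) ++ z)).Nodup :=
      nodup_of_length_le cs hw hzx'.symm (by simp [← hz])
    have hcomm : posProd M (altWord i j (M i j) ++ z) = posProd M (altWord j i (M i j) ++ z) := by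
      rw [posProd_append, posProd_append, posProd_altWord_comm hij hM]
    obtain ⟨m, hm⟩ := Nat.exists_eq_succ_of_ne_zero hM
    rw [hm] at hzx n₁ hcomm hzx' n₂
    simp only [altWord, List.cons_append] at hzx n₁ hcomm hzx' n₂
    rw [same_head hw n₁ hzx.symm hn, hcomm]
    exact (same_head hw' n₂ (h.symm.trans hzx'.symm) hlen).symm

end Matsumoto

section CosetWalk

variable {B W : Type*} [Group W] {M : CoxeterMatrix B} (cs : CoxeterSystem M W) (T : Set B)

/-- The minimal representatives of the cosets `W_T \ W`: the elements that are inverted by no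
reflection in `W_T`. -/
def minReps : Set W :=
  {x | ∀ r ∈ Subgroup.closure (cs.simple '' T), reflCocycle cs x r = 0}

theorem one_mem_minReps : (1 : W) ∈ minReps cs T := fun r _ => reflCocycle_one cs r

variable {T}

theorem eq_of_mul_eq_mul_of_mem_minReps {v v' x x' : W}
    (hv : v ∈ Subgroup.closure (cs.simple '' T)) (hv' : v' ∈ Subgroup.closure (cs.simple '' T))
    (hx : x ∈ minReps cs T) (hx' : x' ∈ minReps cs T) (h : v * x = v' * x') : x = x' := by
  have hu := mul_mem (inv_mem hv') hv
  have h' : v'⁻¹ * v * x = x' := by rw [mul_assoc, h, inv_mul_cancel_left]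
  set u := v'⁻¹ * v
  by_contra hne
  have hu1 : u ≠ 1 := by
    rintro h1
    rw [h1, one_mul] at h'
    exact hne h'
  obtain ⟨i, hi, hui⟩ := exists_reflCocycle_simple_eq_one cs hu hu1
  have hi' : cs.simple i ∈ Subgroup.closure (cs.simple '' T) :=
    Subgroup.subset_closure ⟨i, hi, rfl⟩
  have h0 := hx' _ hi'
  rw [← h', reflCocycle_mul, hui, hx _ (mul_mem (mul_mem (inv_mem hu) hi') hu)] at h0
  simp at h0

/-- Multiplying a minimal representative on the right by a simple reflection either gives a minimal
representative or stays in the same coset, where it amounts to multiplying on the left by a simple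
reflection in `T`. -/
theorem mul_simple_mem_minReps {x : W} (hx : x ∈ minReps cs T) {s : B}
    (h : ∀ t ∈ T, x * cs.simple s ≠ cs.simple t * x) : x * cs.simple s ∈ minReps cs T := by
  classical
  intro r hr
  rw [reflCocycle_mul, hx r hr, zero_add, reflCocycle_simple, if_neg]
  intro hrs
  have hrx : r * x = x * cs.simple s := by rw [← hrs]; group
  have hr1 : r ≠ 1 := by
    rintro rfl
    have := cs.length_simple s
    rw [← hrs] at this
    simp at this
  obtain ⟨t, ht, hrt⟩ := exists_reflCocycle_simple_eq_one cs hr hr1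
  have ht' : cs.simple t ∈ Subgroup.closure (cs.simple '' T) :=
    Subgroup.subset_closure ⟨t, ht, rfl⟩
  have h1 : reflCocycle cs (r * x) (cs.simple t) = 1 := by
    rw [reflCocycle_mul, hrt, hx _ (mul_mem (mul_mem (inv_mem hr) ht') hr), add_zero]
  rw [hrx, reflCocycle_mul, hx _ ht', zero_add, reflCocycle_simple] at h1
  have hts : x⁻¹ * cs.simple t * x = cs.simple s := by
    by_contra hne
    simp [hne] at h1
  refine h t ht ?_
  rw [← hts]
  group

variable (T) in
open Classical in
/-- The letter of `T` by which crossing the edge `s` at the coset of `x` is recorded, if any. -/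
noncomputable def edgeLabel (x : W) (s : B) : Option B :=
  if h : ∃ t ∈ T, x * cs.simple s = cs.simple t * x then some h.choose else none

theorem edgeLabel_eq_some_iff {x : W} {s t : B} :
    edgeLabel cs T x s = some t ↔ t ∈ T ∧ x * cs.simple s = cs.simple t * x := by
  rw [edgeLabel]
  split_ifs with h
  · rw [Option.some_inj]
    constructor
    · rintro rfl
      exact h.choose_spec
    · rintro ⟨-, ht⟩
      refine simple_injective cs (mul_right_cancel (b := x) ?_)
      exact h.choose_spec.2.symm.trans ht
  · simp only [false_iff]
    exact fun ht => h ⟨t, ht⟩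

theorem edgeLabel_eq_none_iff {x : W} {s : B} :
    edgeLabel cs T x s = none ↔ ∀ t ∈ T, x * cs.simple s ≠ cs.simple t * x := by
  rw [Option.eq_none_iff_forall_ne_some]
  simp [edgeLabel_eq_some_iff]

variable (T) in
/-- The minimal representative of the coset of `x s`. -/
noncomputable def nextRep (x : minReps cs T) (s : B) : minReps cs T :=
  match h : edgeLabel cs T (x : W) s with
  | some _ => x
  | none => ⟨x * cs.simple s, mul_simple_mem_minReps cs x.2 ((edgeLabel_eq_none_iff cs).mp h)⟩

theorem nextRep_of_some {x : minReps cs T} {s t : B} (h : edgeLabel cs T (x : W) s = some t) :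
    nextRep cs T x s = x := by
  unfold nextRep
  split <;> simp_all

theorem nextRep_of_none {x : minReps cs T} {s : B} (h : edgeLabel cs T (x : W) s = none) :
    (nextRep cs T x s : W) = x * cs.simple s := by
  unfold nextRep
  split <;> simp_all

theorem edgeLabel_nextRep (x : minReps cs T) (s : B) :
    edgeLabel cs T (nextRep cs T x s : W) s = edgeLabel cs T (x : W) s := by
  cases h : edgeLabel cs T (x : W) s with
  | some t => rw [nextRep_of_some cs h, h]
  | none =>
    rw [nextRep_of_none cs h, edgeLabel_eq_none_iff]
    intro t ht hxt
    rw [← mul_assoc, mul_left_inj] at hxt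
    exact (edgeLabel_eq_none_iff cs).mp h t ht hxt

theorem nextRep_nextRep (x : minReps cs T) (s : B) :
    nextRep cs T (nextRep cs T x s) s = x := by
  cases h : edgeLabel cs T (x : W) s with
  | some t => rw [nextRep_of_some cs h, nextRep_of_some cs h]
  | none =>
    ext
    rw [nextRep_of_none cs ((edgeLabel_nextRep cs x s).trans h), nextRep_of_none cs h,
      cs.simple_mul_simple_cancel_right]

variable (T) in
/-- The word over `T` recorded along a walk starting at `x`. -/
noncomputable def walkLabel : minReps cs T → List B → List B
  | _, [] => []
  | x, s :: w => (edgeLabel cs T (x : W) s).toList ++ walkLabel (nextRep cs T x s) w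

variable (T) in
/-- The end of a walk starting at `x`. -/
noncomputable def walkEnd (x : minReps cs T) (w : List B) : minReps cs T :=
  w.foldl (nextRep cs T) x

theorem mem_of_mem_walkLabel (x : minReps cs T) (w : List B) : ∀ t ∈ walkLabel cs T x w, t ∈ T := by
  induction w generalizing x with
  | nil => simp [walkLabel]
  | cons s w ih =>
    intro t ht
    rw [walkLabel, List.mem_append, Option.mem_toList, edgeLabel_eq_some_iff] at ht
    exact ht.elim (fun h => h.1) (ih _ t)

theorem wordProd_walkLabel_mul_walkEnd (x : minReps cs T) (w : List B) :
    cs.wordProd (walkLabel cs T x w) * (walkEnd cs T x w : W) = x * cs.wordProd w := by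
  induction w generalizing x with
  | nil => simp [walkLabel, walkEnd]
  | cons s w ih =>
    have h := ih (nextRep cs T x s)
    rw [walkLabel, cs.wordProd_append, mul_assoc, cs.wordProd_cons]
    change _ * (_ * (walkEnd cs T (nextRep cs T x s) w : W)) = _
    rw [h]
    cases hs : edgeLabel cs T (x : W) s with
    | some t =>
      rw [nextRep_of_some cs hs, ← mul_assoc (x : W), ((edgeLabel_eq_some_iff cs).mp hs).2]
      simp [mul_assoc]
    | none =>
      rw [nextRep_of_none cs hs]
      simp [mul_assoc]

theorem leftInvSeq_walkLabel_sublist (x : minReps cs T) (w : List B) :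
    (cs.leftInvSeq (walkLabel cs T x w)).Sublist
      ((cs.leftInvSeq w).map (MulAut.conj (x : W))) := by
  induction w generalizing x with
  | nil => simp [walkLabel]
  | cons s w ih =>
    have h := ih (nextRep cs T x s)
    rw [walkLabel, CoxeterSystem.leftInvSeq, List.map_cons, List.map_map, ← MulAut.coe_mul,
      ← map_mul]
    cases hs : edgeLabel cs T (x : W) s with
    | some t =>
      obtain ⟨-, hst⟩ := (edgeLabel_eq_some_iff cs).mp hs
      rw [nextRep_of_some cs hs] at h ⊢
      rw [Option.toList_some, List.singleton_append, CoxeterSystem.leftInvSeq, MulAut.conj_apply,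
        hst, mul_inv_cancel_right, map_mul, MulAut.coe_mul, ← List.map_map]
      exact (h.map _).cons_cons _
    | none =>
      rw [nextRep_of_none cs hs] at h
      rw [Option.toList_none, List.nil_append]
      exact h.cons _

theorem nodup_leftInvSeq_walkLabel (x : minReps cs T) {w : List B} (hw : (cs.leftInvSeq w).Nodup) :
    (cs.leftInvSeq (walkLabel cs T x w)).Nodup :=
  (hw.map (MulAut.conj (x : W)).injective).sublist (leftInvSeq_walkLabel_sublist cs x w)

theorem wordProd_mem_closure {w : List B} (hw : ∀ t ∈ w, t ∈ T) :
    cs.wordProd w ∈ Subgroup.closure (cs.simple '' T) := by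
  refine list_prod_mem fun y hy => ?_
  obtain ⟨t, ht, rfl⟩ := List.mem_map.mp hy
  exact Subgroup.subset_closure ⟨t, hw t ht, rfl⟩

/-- Walks along two reduced words for the same element have the same end, and their labels
represent the same element of the Artin group. -/
theorem walk_eq_of_nodup (x : minReps cs T) {w w' : List B} (hw : (cs.leftInvSeq w).Nodup)
    (hw' : (cs.leftInvSeq w').Nodup) (h : cs.wordProd w = cs.wordProd w') :
    walkEnd cs T x w = walkEnd cs T x w' ∧
      posProd M (walkLabel cs T x w) = posProd M (walkLabel cs T x w') := by
  have hp : cs.wordProd (walkLabel cs T x w) * (walkEnd cs T x w : W) =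
      cs.wordProd (walkLabel cs T x w') * (walkEnd cs T x w' : W) := by
    rw [wordProd_walkLabel_mul_walkEnd, wordProd_walkLabel_mul_walkEnd, h]
  have he := eq_of_mul_eq_mul_of_mem_minReps cs
    (wordProd_mem_closure cs (mem_of_mem_walkLabel cs x w))
    (wordProd_mem_closure cs (mem_of_mem_walkLabel cs x w')) (walkEnd cs T x w).2
    (walkEnd cs T x w').2 hp
  refine ⟨Subtype.ext he, posProd_eq_of_nodup cs (nodup_leftInvSeq_walkLabel cs x hw)
    (nodup_leftInvSeq_walkLabel cs x hw') ?_⟩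
  rwa [he, mul_left_inj] at hp

variable (T) in
/-- The Artin group element recorded at the edge `s` of the coset of `x`. -/
noncomputable def edgeElement (x : minReps cs T) (s : B) : ArtinGroup M :=
  posProd M (edgeLabel cs T (x : W) s).toList

variable (T) in
/-- The right action of a generator of the Artin group on pairs of a coset and an element. -/
noncomputable def walkPerm (s : B) : Equiv.Perm (minReps cs T × ArtinGroup M) where
  toFun p := (nextRep cs T p.1 s, p.2 * edgeElement cs T p.1 s)
  invFun p := (nextRep cs T p.1 s, p.2 * (edgeElement cs T p.1 s)⁻¹)
  left_inv p := by simp [edgeElement, edgeLabel_nextRep, nextRep_nextRep]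
  right_inv p := by simp [edgeElement, edgeLabel_nextRep, nextRep_nextRep]

theorem unop_prod_walkPerm_apply (w : List B) (x : minReps cs T) (a : ArtinGroup M) :
    (w.map fun s => MulOpposite.op (walkPerm cs T s)).prod.unop (x, a) =
      (walkEnd cs T x w, a * posProd M (walkLabel cs T x w)) := by
  induction w generalizing x a with
  | nil => simp [walkEnd, walkLabel, posProd]
  | cons s w ih =>
    rw [List.map_cons, List.prod_cons, MulOpposite.unop_mul, Equiv.Perm.mul_apply]
    change (w.map fun s => MulOpposite.op (walkPerm cs T s)).prod.unop
      (nextRep cs T x s, a * edgeElement cs T x s) = _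
    rw [ih, walkLabel, posProd_append, edgeElement, mul_assoc]
    rfl

theorem walkPerm_artinRels (r : FreeGroup B) (hr : r ∈ artinRels M) :
    FreeGroup.lift (fun s => MulOpposite.op (walkPerm cs T s)) r = 1 := by
  obtain ⟨s, t, hst, hM, rfl⟩ := hr
  rw [map_mul, map_inv, mul_inv_eq_one, map_altProd, map_altProd, FreeGroup.lift_apply_of,
    FreeGroup.lift_apply_of, ← prod_map_altWord (fun s => MulOpposite.op (walkPerm cs T s)),
    ← prod_map_altWord (fun s => MulOpposite.op (walkPerm cs T s))]
  refine MulOpposite.unop_injective (Equiv.ext ?_)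
  rintro ⟨x, a⟩
  rw [unop_prod_walkPerm_apply, unop_prod_walkPerm_apply]
  obtain ⟨h₁, h₂⟩ := walk_eq_of_nodup cs x
    (nodup_leftInvSeq_altWord cs hst (Or.inr le_rfl))
    (nodup_leftInvSeq_altWord cs hst.symm (m := M s t) (Or.inr (M.symmetric s t).le))
    (wordProd_altWord_comm cs s t)
  rw [h₁, h₂]

variable (T) in
/-- The right action of the Artin group on pairs of a coset and an element. -/
noncomputable def walkAction : ArtinGroup M →* (Equiv.Perm (minReps cs T × ArtinGroup M))ᵐᵒᵖ :=
  PresentedGroup.toGroup (walkPerm_artinRels cs (T := T))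

theorem walkAction_artinGen (s : B) :
    walkAction cs T (artinGen M s) = MulOpposite.op (walkPerm cs T s) :=
  PresentedGroup.toGroup.of _

end CosetWalk

section Convexity

variable {B W : Type*} [Group W] {M : CoxeterMatrix B} (cs : CoxeterSystem M W) {T : Set B}

theorem edgeLabel_one_eq_some_iff {s t : B} : edgeLabel cs T 1 s = some t ↔ s ∈ T ∧ s = t := by
  rw [edgeLabel_eq_some_iff, one_mul, mul_one]
  constructor
  · rintro ⟨ht, h⟩
    obtain rfl := simple_injective cs h
    exact ⟨ht, rfl⟩
  · rintro ⟨hs, rfl⟩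
    exact ⟨hs, rfl⟩

theorem walkAction_apply_of_mem {α : ArtinGroup M} (hα : α ∈ subgroupOf (artinGen M) T)
    (a : ArtinGroup M) :
    (walkAction cs T α).unop (⟨1, one_mem_minReps cs T⟩, a) =
      (⟨1, one_mem_minReps cs T⟩, a * α) := by
  rw [subgroupOf] at hα
  induction hα using Subgroup.closure_induction generalizing a with
  | mem x hx =>
    obtain ⟨s, hs, rfl⟩ := hx
    have h : edgeLabel cs T 1 s = some s := (edgeLabel_one_eq_some_iff cs).mpr ⟨hs, rfl⟩
    rw [walkAction_artinGen]
    change (nextRep cs T _ s, a * edgeElement cs T _ s) = _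
    rw [nextRep_of_some cs h, edgeElement, h]
    simp [posProd]
  | one => simp
  | mul x y _ _ hx hy =>
    rw [map_mul, MulOpposite.unop_mul, Equiv.Perm.mul_apply, hx, hy, mul_assoc]
  | inv x _ hx =>
    rw [map_inv, MulOpposite.unop_inv, Equiv.Perm.inv_eq_iff_eq, hx, inv_mul_cancel_right]

/-- Every word `w` is carried by the action to a word over `T` that is at most as long, and shorter
unless `w` is over `T`. -/
theorem exists_retracted_word (w : List (B × Bool)) (x : minReps cs T) :
    ∃ (w' : List (B × Bool)) (y : minReps cs T),
      (∀ a, (walkAction cs T (wordProd (artinGen M) w)).unop (x, a) =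
        (y, a * wordProd (artinGen M) w')) ∧ w'.length ≤ w.length ∧
      ((x : W) = 1 → w.length ≤ w'.length → ∀ l ∈ w, l.1 ∈ T) := by
  induction w generalizing x with
  | nil => exact ⟨[], x, by simp [wordProd], le_rfl, by simp⟩
  | cons l w ih =>
    obtain ⟨s, e⟩ := l
    obtain ⟨w', y, hy, hlen, hT⟩ := ih (nextRep cs T x s)
    refine ⟨(edgeLabel cs T (x : W) s).toList.map (·, e) ++ w', y, fun a => ?_, ?_, ?_⟩
    · have hstep : (walkAction cs T (cond e (artinGen M s) (artinGen M s)⁻¹)).unop (x, a) =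
          (nextRep cs T x s,
            a * wordProd (artinGen M) ((edgeLabel cs T (x : W) s).toList.map (·, e))) := by
        cases e
        · rw [cond_false, map_inv, walkAction_artinGen]
          change (nextRep cs T x s, a * (edgeElement cs T x s)⁻¹) = _
          rw [edgeElement]
          cases edgeLabel cs T (x : W) s <;> simp [posProd, wordProd]
        · rw [cond_true, walkAction_artinGen]
          change (nextRep cs T x s, a * edgeElement cs T x s) = _
          rw [edgeElement]
          cases edgeLabel cs T (x : W) s <;> simp [posProd, wordProd]
      have happ (u v : List (B × Bool)) : wordProd (artinGen M) (u ++ v) =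
          wordProd (artinGen M) u * wordProd (artinGen M) v := by simp [wordProd]
      have hcons : wordProd (artinGen M) ((s, e) :: w) =
          cond e (artinGen M s) (artinGen M s)⁻¹ * wordProd (artinGen M) w := by simp [wordProd]
      rw [hcons, map_mul, MulOpposite.unop_mul, Equiv.Perm.mul_apply, hstep, hy, happ, mul_assoc]
    · cases edgeLabel cs T (x : W) s <;> simp <;> omega
    · intro hx hl
      cases hs : edgeLabel cs T (x : W) s with
      | none =>
        rw [hs] at hl
        simp at hl
        omega
      | some t =>
        rw [hs] at hl
        simp at hl
        rw [nextRep_of_some cs hs] at hT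
        rw [hx, edgeLabel_one_eq_some_iff] at hs
        exact List.forall_mem_cons.mpr ⟨hs.1, hT hx hl⟩

theorem length_le_of_isExpression {ι G : Type*} [Group G] {x : ι → G} {α : G}
    {w : List (ι × Bool)} (hw : IsExpression x α w) : length x α ≤ w.length :=
  Nat.sInf_le ⟨w, hw, rfl⟩

theorem exists_isGeodesic {ι G : Type*} [Group G] (x : ι → G)
    (h : Subgroup.closure (Set.range x) = ⊤) (α : G) : ∃ w, IsGeodesic x α w := by
  obtain ⟨w, hw⟩ := exists_isExpression x h α
  exact Nat.sInf_mem (s := {n | ∃ w : List (ι × Bool), IsExpression x α w ∧ w.length = n})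
    ⟨_, w, hw, rfl⟩

theorem isConvex_artinGen (M : CoxeterMatrix B) (T : Set B) : IsConvex (artinGen M) T := by
  intro α hα w hw
  obtain ⟨w', y, hy, -, hT⟩ := exists_retracted_word M.toCoxeterSystem w
    ⟨1, one_mem_minReps M.toCoxeterSystem T⟩
  have h := hy 1
  rw [show wordProd (artinGen M) w = α from hw.1, walkAction_apply_of_mem _ hα, Prod.mk.injEq,
    one_mul, one_mul] at h
  exact hT rfl (hw.2 ▸ length_le_of_isExpression h.2.symm)

theorem coe_wordProd_subgroupGen {ι G : Type*} [Group G] (x : ι → G) (T : Set ι)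
    (w : List (T × Bool)) :
    ((wordProd (subgroupGen x T) w : subgroupOf x T) : G) = wordProd x (w.map (Prod.map Subtype.val id)) := by
  induction w with
  | nil => simp [wordProd]
  | cons l w ih =>
    obtain ⟨t, e⟩ := l
    simp only [wordProd, List.map_cons, List.prod_cons, Subgroup.coe_mul] at ih ⊢
    rw [ih]
    cases e <;> rfl

theorem IsConvex.isIsometricallyEmbedded {ι G : Type*} [Group G] {x : ι → G} {T : Set ι}
    (hx : Subgroup.closure (Set.range x) = ⊤) (h : IsConvex x T) : IsIsometricallyEmbedded x T := by
  intro α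
  apply le_antisymm
  · obtain ⟨w, hw, hl⟩ := exists_isGeodesic _ (closure_range_subgroupGen x T) α
    rw [← hl, ← List.length_map (as := w) (Prod.map Subtype.val id)]
    refine length_le_of_isExpression ?_
    rw [IsExpression, ← coe_wordProd_subgroupGen, show wordProd _ w = α from hw]
  · obtain ⟨w, hw⟩ := exists_isGeodesic x hx α
    have hT := h α α.2 w hw
    let w' : List (T × Bool) := w.attach.map fun l => (⟨l.1.1, hT l.1 l.2⟩, l.1.2)
    have hw' : w'.map (Prod.map Subtype.val id) = w := by
      simp only [w', List.map_map]
      exact w.attach_map_subtype_val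
    rw [← hw.2, ← hw', List.length_map]
    refine length_le_of_isExpression (Subtype.ext ?_)
    rw [coe_wordProd_subgroupGen, hw']
    exact hw.1

end Convexity

end ArtinConvexity

theorem theorem1p2 {S : Type*} [Finite S] (M : CoxeterMatrix S) (T : Set S) :
    ArtinConvexity.IsConvex (ArtinConvexity.artinGen M) T ∧
      ArtinConvexity.IsIsometricallyEmbedded (ArtinConvexity.artinGen M) T :=
  ⟨ArtinConvexity.isConvex_artinGen M T,
    (ArtinConvexity.isConvex_artinGen M T).isIsometricallyEmbedded
      (ArtinConvexity.closure_range_artinGen M)⟩
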